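/- For $N\ge 0$ let $\mathcal A^{\rm h}_N$ be the unital complex algebra generated by the chords $t_{ij}=t_{ji}$ ($1\le i\neq j\le N$), that is, spanned by horizontal chord diagrams (words in the chords), modulo the infinitesimal pure braid relations $[t_{ij},t_{kl}]=0$ for pairwise distinct $i,j,k,l$ and $[t_{ij},t_{ik}+t_{jk}]=0$ for pairwise distinct $i,j,k$; it is a $\star$-algebra under the antilinear involution that reads every diagram backwards. A quantum state on a complex $\star$-algebra $\mathscr O$ is a linear map $\varphi:\mathscr O\to\mathbb C$ with $\varphi(xx^\star)\ge 0$ for all $x\in\mathscr O$ and $\varphi(1)>0$. Equip $\mathfrak{gl}_2=\mathfrak{gl}_2(\mathbb C)$ with the form $\langle A,B\rangle=\operatorname{Tr}(AB)$ and let $(e_r)$ be an orthonormal basis. For representations $\rho_i:\mathfrak{gl}_2\to\operatorname{End}(V_i)$, $1\le i\le N$, on finite-dimensional complex vector spaces, there is an algebra morphism $\widetilde W_{\underline\rho}:\mathcal A^{\rm h}_N\to\operatorname{End}(V_1\otimes\cdots\otimes V_N)$ sending $t_{ij}$ to $\sum_r \rho_i(e_r)\rho_j(e_r)$, where $\rho_i(e_r)$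 acts on the $i$-th and $\rho_j(e_r)$ on the $j$-th tensor factor; the $\mathfrak{gl}_2$-weight system of the labelling $\underline\rho=(\rho_1,\dots,\rho_N)$ is $W_{\underline\rho}=\operatorname{Tr}\circ\widetilde W_{\underline\rho}:\mathcal A^{\rm h}_N\to\mathbb C$. For a Young diagram $\lambda$ with at most two rows, let $\mathbb S_\lambda(\mathbb C^2)\subseteq(\mathbb C^2)^{\otimes|\lambda|}$ be the image of a Young symmetriser of shape $\lambda$. A representation of $\mathfrak{gl}_2$ is called an irreducible Young diagram representation if, for some such $\lambda$, it is isomorphic to $\mathbb S_\lambda(\mathbb C^2)$ with $\mathfrak{sl}_2$ acting by restriction from $(\mathbb C^2)^{\otimes|\lambda|}$ and the identity matrix acting either by the scalar $1$ or by the scalar $|\lambda|$ (the latter being the restriction of the natural $\mathfrak{gl}_2$-action on $(\mathbb C^2)^{\otimes|\lambda|}$, which for $\lambda=(k)$ gives the symmetric power $\operatorname{Sym}^k\mathbb C^2$). Corollary. For every $N$ and every labelling $\underline\rho=(\rho_1,\dots,\rho_N)$ by irreducible Young diagram representations of $\mathfrak{gl}_2$, the weight system $W_{\underline\rho}$ is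 a quantum state on $\mathcal A^{\rm h}_N$. -/

import Mathlib

open scoped TensorProduct ComplexOrder

attribute [local instance 100] LieRing.ofAssociativeRing

noncomputable section

namespace ChordDiagram

/-! ### The star-algebra of horizontal chord diagrams on `N` strands -/

/-- A chord: a pair `(i, j)` of strands with `i < j`. -/
abbrev Chord (N : ℕ) : Type := {p : Fin N × Fin N // p.1 < p.2}

/-- The chord joining two distinct strands. -/
def chord {N : ℕ} (i j : Fin N) (h : i ≠ j) : Chord N :=
  ⟨(min i j, max i j), min_lt_max.mpr h⟩

/-- Horizontal chord diagrams on `N` strands: the free monoid on the chords. -/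
abbrev Diagram (N : ℕ) : Type := FreeMonoid (Chord N)

/-- The diagram with the single chord `c`, as an element of `ℂ[D_N]`. -/
def gen {N : ℕ} (c : Chord N) : MonoidAlgebra ℂ (Diagram N) :=
  MonoidAlgebra.of ℂ (Diagram N) (FreeMonoid.of c)

/-- The infinitesimal pure braid relations. -/
inductive BraidRel (N : ℕ) :
    MonoidAlgebra ℂ (Diagram N) → MonoidAlgebra ℂ (Diagram N) → Prop
  /-- Chords without a common strand commute. -/
  | twoT (i j k l : Fin N) (hij : i ≠ j) (hkl : k ≠ l)
      (hik : i ≠ k) (hil : i ≠ l) (hjk : j ≠ k) (hjl : j ≠ l) :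
      BraidRel N (gen (chord i j hij) * gen (chord k l hkl))
        (gen (chord k l hkl) * gen (chord i j hij))
  /-- The four-term relation on three distinct strands. -/
  | fourT (i j k : Fin N) (hij : i ≠ j) (hik : i ≠ k) (hjk : j ≠ k) :
      BraidRel N
        (gen (chord i j hij) * gen (chord i k hik) + gen (chord i j hij) * gen (chord j k hjk))
        (gen (chord i k hik) * gen (chord i j hij) + gen (chord j k hjk) * gen (chord i j hij))

/-- The algebra of horizontal chord diagrams on `N` strands. -/
abbrev Alg (N : ℕ) : Type := RingQuot (BraidRel N)

/-- The class of a diagram. -/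
def diag {N : ℕ} : Diagram N →* Alg N :=
  (RingQuot.mkAlgHom ℂ (BraidRel N) : MonoidAlgebra ℂ (Diagram N) →* Alg N).comp
    (MonoidAlgebra.of ℂ (Diagram N))

/-- "Reading backwards", with values in the opposite algebra. -/
def revHom (N : ℕ) : Diagram N →* (Alg N)ᵐᵒᵖ :=
  FreeMonoid.lift fun c => MulOpposite.op (diag (FreeMonoid.of c))

/-- Antilinear extension of `revHom` to `ℂ[D_N]`. -/
def preStar (N : ℕ) : MonoidAlgebra ℂ (Diagram N) →+* (Alg N)ᵐᵒᵖ :=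
  MonoidAlgebra.liftNCRingHom
    ((algebraMap ℂ (Alg N)ᵐᵒᵖ).comp (starRingEnd ℂ)) (revHom N)
    (fun z x => Algebra.commute_algebraMap_left (starRingEnd ℂ z) (revHom N x))

theorem preStar_gen {N : ℕ} (c : Chord N) :
    preStar N (gen c) = MulOpposite.op (RingQuot.mkAlgHom ℂ (BraidRel N) (gen c)) := by
  simp [preStar, gen, revHom, diag, MonoidAlgebra.liftNCRingHom]

/-- The involution, as a ring homomorphism into the opposite ring. -/
def starHom (N : ℕ) : Alg N →+* (Alg N)ᵐᵒᵖ :=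
  RingQuot.lift ⟨preStar N, by
    intro x y h
    have key := RingQuot.mkAlgHom_rel ℂ h
    cases h with
    | twoT i j k l hij hkl hik hil hjk hjl =>
      simp only [map_mul, preStar_gen, ← MulOpposite.op_mul] at key ⊢
      rw [key]
    | fourT i j k hij hik hjk =>
      simp only [map_mul, map_add, preStar_gen, ← MulOpposite.op_mul, ← MulOpposite.op_add]
        at key ⊢
      rw [key]⟩

theorem starHom_mk {N : ℕ} (x : MonoidAlgebra ℂ (Diagram N)) :
    starHom N (RingQuot.mkAlgHom ℂ (BraidRel N) x) = preStar N x := by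
  have h : RingQuot.mkAlgHom ℂ (BraidRel N) x = RingQuot.mkRingHom (BraidRel N) x :=
    congrArg (fun f : MonoidAlgebra ℂ (Diagram N) →+* Alg N => f x)
      (RingQuot.mkAlgHom_coe ℂ (BraidRel N))
  rw [h, starHom]
  exact RingQuot.lift_mkRingHom_apply _ _ _

theorem revHom_eq {N : ℕ} (D : Diagram N) : revHom N D = MulOpposite.op (diag (star D)) := by
  induction D using FreeMonoid.inductionOn' with
  | one => simp
  | of_mul c D ih =>
    rw [map_mul, star_mul, map_mul, ih, MulOpposite.op_mul, FreeMonoid.star_of]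
    simp [revHom]

/-- The involution sends `z • [D]` to `conj z • [D read backwards]`. -/
theorem starHom_smul_diag {N : ℕ} (z : ℂ) (D : Diagram N) :
    starHom N (z • diag D) = MulOpposite.op (starRingEnd ℂ z • diag (star D)) := by
  have h : z • diag D = RingQuot.mkAlgHom ℂ (BraidRel N) (MonoidAlgebra.single D z) := by
    rw [diag, MonoidHom.comp_apply, MonoidAlgebra.of_apply]
    simp only [MonoidHom.coe_coe, ← map_smul]
    simp
  rw [h, starHom_mk, preStar, MonoidAlgebra.liftNCRingHom_single, revHom_eq]
  simp [Algebra.smul_def, Algebra.commutes]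

theorem alg_induction {N : ℕ} {p : Alg N → Prop} (x : Alg N)
    (hd : ∀ (z : ℂ) (D : Diagram N), p (z • diag D))
    (ha : ∀ x y, p x → p y → p (x + y)) : p x := by
  obtain ⟨y, rfl⟩ := RingQuot.mkAlgHom_surjective ℂ (BraidRel N) x
  induction y using MonoidAlgebra.induction_linear with
  | zero => simpa using hd 0 1
  | add f g hf hg => rw [map_add]; exact ha _ _ hf hg
  | single D z =>
    have h := hd z D
    rw [diag, MonoidHom.comp_apply, MonoidAlgebra.of_apply] at h
    simp only [MonoidHom.coe_coe, ← map_smul] at h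
    simpa using h

instance (N : ℕ) : StarRing (Alg N) where
  star x := (starHom N x).unop
  star_involutive x := by
    induction x using alg_induction with
    | hd z D => simp [starHom_smul_diag]
    | ha x y hx hy => simp [hx, hy]
  star_mul x y := by simp
  star_add x y := by simp

theorem star_smul_diag {N : ℕ} (z : ℂ) (D : Diagram N) :
    star (z • diag D : Alg N) = starRingEnd ℂ z • diag (star D) :=
  congrArg MulOpposite.unop (starHom_smul_diag z D)

instance (N : ℕ) : StarModule ℂ (Alg N) where
  star_smul w x := by
    induction x using alg_induction with
    | hd z D => rw [smul_smul, star_smul_diag, star_smul_diag, smul_smul, map_mul]; rfl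
    | ha x y hx hy => rw [smul_add, star_add, hx, hy, star_add, smul_add]

/-! ### Quantum states -/

/-- A state on a complex star-algebra. The inequalities are in `ℂ`: they say that the number
is real and non-negative (resp. positive). -/
def IsQuantumState {A : Type*} [Ring A] [StarRing A] [Algebra ℂ A] [StarModule ℂ A]
    (φ : A →ₗ[ℂ] ℂ) : Prop :=
  (∀ x : A, 0 ≤ φ (x * star x)) ∧ 0 < φ 1

/-! ### Tensor products of representations and Lie algebra weight systems -/

section Tensor

variable {ι : Type*} [DecidableEq ι] {V : ι → Type*} [∀ i, AddCommGroup (V i)]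
  [∀ i, Module ℂ (V i)]

/-- `Id ⊗ ⋯ ⊗ f ⊗ ⋯ ⊗ Id`, with `f` in position `i`. -/
def slot (i : ι) (f : Module.End ℂ (V i)) : Module.End ℂ (⨂[ℂ] i, V i) :=
  PiTensorProduct.map (Function.update (fun _ => LinearMap.id) i f)

theorem slot_tprod (i : ι) (f : Module.End ℂ (V i)) (v : ∀ i, V i) :
    slot i f (PiTensorProduct.tprod ℂ v)
      = PiTensorProduct.tprod ℂ (Function.update v i (f (v i))) := by
  rw [slot, PiTensorProduct.map_tprod]
  congr 1
  funext j
  by_cases h : j = i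
  · subst h; simp
  · simp [h]

theorem slot_add (i : ι) (f g : Module.End ℂ (V i)) : slot i (f + g) = slot i f + slot i g :=
  PiTensorProduct.map_update_add _ _ _ _

theorem slot_smul (i : ι) (z : ℂ) (f : Module.End ℂ (V i)) : slot i (z • f) = z • slot i f :=
  PiTensorProduct.map_update_smul _ _ _ _

/-- `slot i` as a linear map. -/
def slotₗ (i : ι) : Module.End ℂ (V i) →ₗ[ℂ] Module.End ℂ (⨂[ℂ] i, V i) where
  toFun := slot i
  map_add' := slot_add i
  map_smul' := slot_smul i

theorem slot_mul (i : ι) (f g : Module.End ℂ (V i)) : slot i (f * g) = slot i f * slot i g := by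
  ext v
  simp [slot_tprod]

theorem slot_comm {i j : ι} (h : i ≠ j) (f : Module.End ℂ (V i)) (g : Module.End ℂ (V j)) :
    slot i f * slot j g = slot j g * slot i f := by
  ext v
  simp [slot_tprod, h, h.symm, Function.update_comm h]

theorem slot_lie (i : ι) (f g : Module.End ℂ (V i)) :
    slot i ⁅f, g⁆ = ⁅slot i f, slot i g⁆ := by
  rw [Ring.lie_def, Ring.lie_def, ← slot_mul, ← slot_mul]
  exact map_sub (slotₗ i) _ _

variable {𝔤 : Type*} [LieRing 𝔤] [LieAlgebra ℂ 𝔤]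

/-- The tensor product of representations: `x` acts by `∑ i, Id ⊗ ⋯ ⊗ ρ i x ⊗ ⋯ ⊗ Id`. -/
def tensorRep [Fintype ι] (ρ : ∀ i, 𝔤 →ₗ⁅ℂ⁆ Module.End ℂ (V i)) :
    𝔤 →ₗ⁅ℂ⁆ Module.End ℂ (⨂[ℂ] i, V i) where
  toFun x := ∑ i, slot i (ρ i x)
  map_add' x y := by simp [slot_add, Finset.sum_add_distrib]
  map_smul' z x := by simp [slot_smul, Finset.smul_sum]
  map_lie' {x y} := by
    rw [Ring.lie_def, Finset.sum_mul_sum, Finset.sum_mul_sum, 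
      Finset.sum_comm (f := fun i j => slot i (ρ i y) * slot j (ρ j x)), ← Finset.sum_sub_distrib]
    refine Finset.sum_congr rfl fun i _ => ?_
    rw [← Finset.sum_sub_distrib, Finset.sum_eq_single i]
    · rw [LieHom.map_lie, slot_lie, Ring.lie_def]
    · intro j _ hj
      rw [slot_comm hj.symm, sub_self]
    · simp

/-- The endomorphism of the chord `(i, j)`:
`∑ r, Id ⊗ ⋯ ⊗ ρ i (e r) ⊗ ⋯ ⊗ ρ j (e r) ⊗ ⋯ ⊗ Id`. -/
def chordOp {κ : Type*} [Fintype κ] (e : κ → 𝔤) (ρ : ∀ i, 𝔤 →ₗ⁅ℂ⁆ Module.End ℂ (V i))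
    (i j : ι) : Module.End ℂ (⨂[ℂ] i, V i) :=
  ∑ r, slot i (ρ i (e r)) * slot j (ρ j (e r))

theorem chordOp_comm {κ : Type*} [Fintype κ] (e : κ → 𝔤)
    (ρ : ∀ i, 𝔤 →ₗ⁅ℂ⁆ Module.End ℂ (V i)) {i j : ι} (h : i ≠ j) :
    chordOp e ρ i j = chordOp e ρ j i :=
  Finset.sum_congr rfl fun _ _ => slot_comm h _ _

end Tensor

/-- `e` is an orthonormal basis of the Lie algebra `𝔤` for the bilinear form `B`, and `B` is
`ad`-invariant. (A bilinear form with an orthonormal basis is symmetric and non-degenerate, and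
over `ℂ` every symmetric non-degenerate form has one.) -/
structure IsMetricBasis {𝔤 : Type*} [LieRing 𝔤] [LieAlgebra ℂ 𝔤] {κ : Type*} [DecidableEq κ]
    (B : LinearMap.BilinForm ℂ 𝔤) (e : Module.Basis κ ℂ 𝔤) : Prop where
  invariant : ∀ x y z, B ⁅x, y⁆ z = B x ⁅y, z⁆
  orthonormal : ∀ r s, B (e r) (e s) = if r = s then 1 else 0

section Weight

variable {𝔤 : Type*} [LieRing 𝔤] [LieAlgebra ℂ 𝔤] {κ : Type*} [Fintype κ] [DecidableEq κ]
  {B : LinearMap.BilinForm ℂ 𝔤} {e : Module.Basis κ ℂ 𝔤}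

theorem IsMetricBasis.symm {κ : Type*} [DecidableEq κ] {e : Module.Basis κ ℂ 𝔤} (he : IsMetricBasis B e) (x y : 𝔤) : B x y = B y x := by
  have h : B = B.flip := by
    refine LinearMap.BilinForm.ext_basis e fun r s => ?_
    rw [LinearMap.BilinForm.flip_apply, he.orthonormal, he.orthonormal]
    simp only [eq_comm]
  conv_lhs => rw [h]
  rfl

theorem IsMetricBasis.expand (he : IsMetricBasis B e) (x : 𝔤) : x = ∑ s, B x (e s) • e s := by
  conv_lhs => rw [← e.sum_repr x]
  refine Finset.sum_congr rfl fun s _ => ?_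
  congr 1
  have h : e.coord s = B.flip (e s) := by
    refine e.ext fun r => ?_
    rw [LinearMap.BilinForm.flip_apply, he.orthonormal]
    simp [Finsupp.single_apply]
  exact LinearMap.congr_fun h x

theorem IsMetricBasis.antisymm {κ : Type*} [DecidableEq κ] {e : Module.Basis κ ℂ 𝔤}
    (he : IsMetricBasis B e) (x : 𝔤) (r s : κ) :
    B ⁅e r, x⁆ (e s) = - B ⁅e s, x⁆ (e r) := by
  rw [he.invariant (e s), ← lie_skew, map_neg, LinearMap.neg_apply, he.symm]

variable {N : ℕ} {V : Fin N → Type*} [∀ i, AddCommGroup (V i)] [∀ i, Module ℂ (V i)]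

/-- The chord endomorphism commutes with the diagonal action on its two strands. -/
theorem chordOp_invariant (he : IsMetricBasis B e) (ρ : ∀ i, 𝔤 →ₗ⁅ℂ⁆ Module.End ℂ (V i))
    {i j : Fin N} (h : i ≠ j) (x : 𝔤) :
    chordOp e ρ i j * (slot i (ρ i x) + slot j (ρ j x))
      = (slot i (ρ i x) + slot j (ρ j x)) * chordOp e ρ i j := by
  rw [← sub_eq_zero, chordOp, Finset.sum_mul, Finset.mul_sum, ← Finset.sum_sub_distrib]
  have h1 : ∀ r, slot i (ρ i (e r)) * slot j (ρ j (e r)) * (slot i (ρ i x) + slot j (ρ j x))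
      - (slot i (ρ i x) + slot j (ρ j x)) * (slot i (ρ i (e r)) * slot j (ρ j (e r)))
      = slot i (ρ i ⁅e r, x⁆) * slot j (ρ j (e r))
        + slot i (ρ i (e r)) * slot j (ρ j ⁅e r, x⁆) := by
    intro r
    have c1 := slot_comm h (ρ i x) (ρ j (e r))
    have c2 := slot_comm h (ρ i (e r)) (ρ j x)
    rw [LieHom.map_lie, LieHom.map_lie, slot_lie, slot_lie, Ring.lie_def, Ring.lie_def]
    simp only [mul_add, add_mul, sub_mul, mul_sub, mul_assoc]
    rw [← c1, ← mul_assoc (slot j (ρ j x)), ← c2, mul_assoc]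
    abel
  have h2 : ∀ (k : Fin N) (r : κ), slot k (ρ k ⁅e r, x⁆)
      = ∑ s, B ⁅e r, x⁆ (e s) • slot k (ρ k (e s)) := by
    intro k r
    conv_lhs => rw [he.expand ⁅e r, x⁆]
    simp only [map_sum, map_smul]
    exact (map_sum (slotₗ k) (fun s => B ⁅e r, x⁆ (e s) • ρ k (e s)) Finset.univ).trans
      (Finset.sum_congr rfl fun s _ => slot_smul k _ _)
  simp only [h1, h2, Finset.sum_add_distrib, Finset.sum_mul, Finset.mul_sum, smul_mul_assoc,
    mul_smul_comm]
  rw [Finset.sum_comm, ← Finset.sum_add_distrib]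
  refine Finset.sum_eq_zero fun r _ => ?_
  rw [← Finset.sum_add_distrib]
  refine Finset.sum_eq_zero fun s _ => ?_
  rw [he.antisymm x s r, ← add_smul, neg_add_cancel, zero_smul]

/-- The chord endomorphisms, extended multiplicatively and linearly to `ℂ[D_N]`. -/
def preWeight (e : Module.Basis κ ℂ 𝔤) (ρ : ∀ i, 𝔤 →ₗ⁅ℂ⁆ Module.End ℂ (V i)) :
    MonoidAlgebra ℂ (Diagram N) →ₐ[ℂ] Module.End ℂ (⨂[ℂ] i, V i) :=
  MonoidAlgebra.lift ℂ _ (Diagram N) (FreeMonoid.lift fun c => chordOp e ρ c.1.1 c.1.2)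

theorem preWeight_gen {κ : Type*} [Fintype κ] {e : Module.Basis κ ℂ 𝔤}
    (ρ : ∀ i, 𝔤 →ₗ⁅ℂ⁆ Module.End ℂ (V i)) {i j : Fin N} (h : i ≠ j) :
    preWeight e ρ (gen (chord i j h)) = chordOp e ρ i j := by
  have h1 : preWeight e ρ (gen (chord i j h)) = chordOp e ρ (min i j) (max i j) := by
    simp [preWeight, gen, chord]
  rw [h1]
  rcases lt_or_gt_of_ne h with h' | h'
  · rw [min_eq_left h'.le, max_eq_right h'.le]
  · rw [min_eq_right h'.le, max_eq_left h'.le, chordOp_comm e ρ h]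

theorem preWeight_rel (he : IsMetricBasis B e) (ρ : ∀ i, 𝔤 →ₗ⁅ℂ⁆ Module.End ℂ (V i))
    ⦃x y : MonoidAlgebra ℂ (Diagram N)⦄ (h : BraidRel N x y) :
    preWeight e ρ x = preWeight e ρ y := by
  cases h with
  | twoT i j k l hij hkl hik hil hjk hjl =>
    simp only [map_mul, preWeight_gen]
    refine Commute.sum_left _ _ _ fun r _ => Commute.sum_right _ _ _ fun s _ => ?_
    refine Commute.mul_left (Commute.mul_right ?_ ?_) (Commute.mul_right ?_ ?_) <;>
      exact slot_comm ‹_› _ _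
  | fourT i j k hij hik hjk =>
    simp only [map_mul, map_add, preWeight_gen, ← mul_add, ← add_mul]
    have h1 : chordOp e ρ i k + chordOp e ρ j k
        = ∑ r, (slot i (ρ i (e r)) + slot j (ρ j (e r))) * slot k (ρ k (e r)) := by
      simp only [chordOp, add_mul, Finset.sum_add_distrib]
    rw [h1]
    refine Commute.sum_right _ _ _ fun r _ => Commute.mul_right ?_ ?_
    · exact chordOp_invariant he ρ hij (e r)
    · exact Commute.sum_left _ _ _ fun s _ =>
        Commute.mul_left (slot_comm hik _ _) (slot_comm hjk _ _)

/-- The algebra morphism from chord diagrams to endomorphisms of `V 1 ⊗ ⋯ ⊗ V N`. -/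
def weightEnd (he : IsMetricBasis B e) (ρ : ∀ i, 𝔤 →ₗ⁅ℂ⁆ Module.End ℂ (V i)) :
    Alg N →ₐ[ℂ] Module.End ℂ (⨂[ℂ] i, V i) :=
  RingQuot.liftAlgHom ℂ ⟨preWeight e ρ, preWeight_rel he ρ⟩

/-- The Lie algebra weight system of a metrised Lie algebra and a labelling `ρ` of the strands. -/
def weightSystem (he : IsMetricBasis B e) (ρ : ∀ i, 𝔤 →ₗ⁅ℂ⁆ Module.End ℂ (V i)) :
    Alg N →ₗ[ℂ] ℂ :=
  LinearMap.trace ℂ (⨂[ℂ] i, V i) ∘ₗ (weightEnd he ρ).toLinearMap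

end Weight

/-! ### Young diagram representations of `𝔤𝔩ₙ` -/

/-- The Lie algebra `𝔤𝔩ₙ` over `ℂ`. -/
abbrev gl (n : ℕ) : Type := Matrix (Fin n) (Fin n) ℂ

/-- The bilinear form `⟨A, B⟩ = Tr (A B)`. -/
def trForm (n : ℕ) : LinearMap.BilinForm ℂ (gl n) :=
  (LinearMap.mul ℂ (gl n)).compr₂ (Matrix.traceLinearMap (Fin n) ℂ ℂ)

/-- The defining representation. -/
def stdRep (n : ℕ) : gl n →ₗ⁅ℂ⁆ Module.End ℂ (Fin n → ℂ) :=
  (Matrix.toLinAlgEquiv' : gl n ≃ₐ[ℂ] Module.End ℂ (Fin n → ℂ)).toAlgHom.toLieHom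

/-- Restriction of a representation to an invariant subspace. -/
def subRep {𝔤 : Type*} [LieRing 𝔤] [LieAlgebra ℂ 𝔤] {V : Type*} [AddCommGroup V] [Module ℂ V]
    (ρ : 𝔤 →ₗ⁅ℂ⁆ Module.End ℂ V) (W : Submodule ℂ V) (h : ∀ x, ∀ v ∈ W, ρ x v ∈ W) :
    𝔤 →ₗ⁅ℂ⁆ Module.End ℂ W where
  toFun x := (ρ x).restrict (h x)
  map_add' x y := by ext v; simp
  map_smul' z x := by ext v; simp
  map_lie' {x y} := by ext v; simp [Ring.lie_def]

/-- Write `x` in `𝔤𝔩ₙ = 𝔰𝔩ₙ ⊕ ℂ·1` as `x = x₀ + k·1` with `k = tr x / n`. The representation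
`twist ρ z` agrees with `ρ` on `𝔰𝔩ₙ` and lets the identity matrix act by the scalar `z`. -/
def twist {n : ℕ} {V : Type*} [AddCommGroup V] [Module ℂ V] (ρ : gl n →ₗ⁅ℂ⁆ Module.End ℂ V)
    (z : ℂ) : gl n →ₗ⁅ℂ⁆ Module.End ℂ V where
  toFun x := ρ (x - (x.trace / n) • (1 : gl n)) + (z * (x.trace / n)) • (1 : Module.End ℂ V)
  map_add' x y := by
    simp only [Matrix.trace_add, add_div, add_smul, mul_add, map_sub, map_add]
    abel
  map_smul' c x := by
    simp only [Matrix.trace_smul, smul_eq_mul, RingHom.id_apply, smul_add, smul_smul, map_sub,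
      map_smul, smul_sub]
    congr 2
    · congr 2; ring
    · ring
  map_lie' {x y} := by
    have h : Matrix.trace ⁅x, y⁆ = 0 := by
      rw [Ring.lie_def, Matrix.trace_sub, Matrix.trace_mul_comm, sub_self]
    have h1 : ∀ a b : ℂ, ⁅x - a • (1 : gl n), y - b • (1 : gl n)⁆ = ⁅x, y⁆ := by
      intro a b
      simp only [Ring.lie_def, sub_mul, mul_sub, smul_mul_assoc, mul_smul_comm, one_mul, mul_one,
        smul_sub]
      rw [smul_comm a b]
      abel
    have h2 : ∀ (f g : Module.End ℂ V) (a b : ℂ),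
        ⁅f + a • (1 : Module.End ℂ V), g + b • (1 : Module.End ℂ V)⁆ = ⁅f, g⁆ := by
      intro f g a b
      simp only [Ring.lie_def, add_mul, mul_add, smul_mul_assoc, mul_smul_comm, one_mul, mul_one,
        smul_add]
      rw [smul_comm a b]
      abel
    rw [h2, ← LieHom.map_lie, h1, h]
    simp

/-- `(ℂⁿ)^{⊗ k}`. -/
abbrev TPow (n k : ℕ) : Type := ⨂[ℂ] _ : Fin k, (Fin n → ℂ)

/-- The action of `𝔖ₖ` on `(ℂⁿ)^{⊗ k}` by permutation of the factors. -/
def permRep (n k : ℕ) : Representation ℂ (Equiv.Perm (Fin k)) (TPow n k) where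
  toFun σ := (PiTensorProduct.reindex ℂ (fun _ => Fin n → ℂ) σ).toLinearMap
  map_one' := by
    refine PiTensorProduct.ext (MultilinearMap.ext fun v => ?_)
    simp only [LinearMap.compMultilinearMap_apply, LinearEquiv.coe_coe]
    exact PiTensorProduct.reindex_tprod _ _
  map_mul' σ τ := by
    refine PiTensorProduct.ext (MultilinearMap.ext fun v => ?_)
    simp only [LinearMap.compMultilinearMap_apply, LinearEquiv.coe_coe, Module.End.mul_apply]
    refine (PiTensorProduct.reindex_tprod (s := fun _ => Fin n → ℂ) (σ * τ) v).trans ?_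
    refine Eq.symm ((congrArg _ (PiTensorProduct.reindex_tprod (s := fun _ => Fin n → ℂ) τ v)).trans
      ?_)
    exact PiTensorProduct.reindex_tprod (s := fun _ => Fin n → ℂ) σ _

/-- A tableau of shape `Y`: a bijective labelling of the boxes by `0, …, |Y| - 1`. -/
abbrev Tableau (Y : YoungDiagram) : Type := Y.cells ≃ Fin Y.card

section Young

variable {Y : YoungDiagram} (t : Tableau Y)

/-- Permutations of the labels that keep each label in its row. -/
def rowStab : Set (Equiv.Perm (Fin Y.card)) := {σ | ∀ a, (t.symm (σ a)).1.1 = (t.symm a).1.1}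

/-- Permutations of the labels that keep each label in its column. -/
def colStab : Set (Equiv.Perm (Fin Y.card)) := {σ | ∀ a, (t.symm (σ a)).1.2 = (t.symm a).1.2}

open Classical in
/-- The (unnormalised) Young symmetriser of a tableau. Rescaling it does not change its image. -/
def youngSymmetriser : MonoidAlgebra ℂ (Equiv.Perm (Fin Y.card)) :=
  (∑ σ with σ ∈ rowStab t, MonoidAlgebra.single σ 1) *
    ∑ σ with σ ∈ colStab t, MonoidAlgebra.single σ ((Equiv.Perm.sign σ : ℤ) : ℂ)

/-- The Weyl module `𝕊_λ(ℂⁿ)`: the image of the Young symmetriser on `(ℂⁿ)^{⊗ |λ|}`. -/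
def weylModule (n : ℕ) : Submodule ℂ (TPow n Y.card) :=
  LinearMap.range ((permRep n Y.card).asAlgebraHom (youngSymmetriser t))

/-- `stdRep ⊗ ⋯ ⊗ stdRep`, with `k` factors. -/
def tpowRep (n k : ℕ) : gl n →ₗ⁅ℂ⁆ Module.End ℂ (TPow n k) := tensorRep fun _ => stdRep n

theorem permRep_slot {n k : ℕ} (σ : Equiv.Perm (Fin k)) (a : Fin k)
    (f : Module.End ℂ (Fin n → ℂ)) :
    permRep n k σ * slot a f = slot (σ a) f * permRep n k σ := by
  have hp : ∀ v : Fin k → Fin n → ℂ, permRep n k σ (PiTensorProduct.tprod ℂ v)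
      = PiTensorProduct.tprod ℂ fun i => v (σ.symm i) :=
    fun v => PiTensorProduct.reindex_tprod _ _
  refine PiTensorProduct.ext (MultilinearMap.ext fun v => ?_)
  simp only [LinearMap.compMultilinearMap_apply, Module.End.mul_apply, slot_tprod, hp]
  congr 1
  funext b
  by_cases h : b = σ a
  · subst h; simp
  · have : σ.symm b ≠ a := fun h' => h (by rw [← h', Equiv.apply_symm_apply])
    simp [h, this]

theorem tpowRep_comm {n k : ℕ} (x : gl n) (c : MonoidAlgebra ℂ (Equiv.Perm (Fin k))) :
    (permRep n k).asAlgebraHom c * tpowRep n k x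
      = tpowRep n k x * (permRep n k).asAlgebraHom c := by
  induction c using MonoidAlgebra.induction_linear with
  | zero => simp
  | add f g hf hg => rw [map_add, add_mul, mul_add, hf, hg]
  | single σ z =>
    rw [Representation.asAlgebraHom_single, smul_mul_assoc, mul_smul_comm]
    congr 1
    change permRep n k σ * ∑ a, slot a (stdRep n x) = (∑ a, slot a (stdRep n x)) * permRep n k σ
    rw [Finset.mul_sum, Finset.sum_mul]
    simp only [permRep_slot]
    let g : Fin k → Module.End ℂ (TPow n k) := fun a => slot a (stdRep n x) * permRep n k σ
    exact Equiv.sum_comp σ g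

theorem weylModule_invariant (n : ℕ) (x : gl n) :
    ∀ v : TPow n Y.card, v ∈ weylModule t n → tpowRep n Y.card x v ∈ weylModule t n := by
  intro v hv
  rw [weylModule, LinearMap.mem_range] at hv ⊢
  obtain ⟨w, hw⟩ := hv
  have h := LinearMap.congr_fun (tpowRep_comm x (youngSymmetriser t)) w
  rw [Module.End.mul_apply, Module.End.mul_apply, hw] at h
  exact ⟨_, h⟩

/-- The Weyl module as a type. -/
def Weyl (n : ℕ) : Type := weylModule t n

instance (n : ℕ) : AddCommGroup (Weyl t n) := inferInstanceAs (AddCommGroup (weylModule t n))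

instance (n : ℕ) : Module ℂ (Weyl t n) := inferInstanceAs (Module ℂ (weylModule t n))

/-- The action of `𝔤𝔩ₙ` on the Weyl module, restricted from `(ℂⁿ)^{⊗ |λ|}`; the identity matrix
acts by `|λ|`. -/
def weylRep (n : ℕ) : gl n →ₗ⁅ℂ⁆ Module.End ℂ (Weyl t n) :=
  subRep (tpowRep n Y.card) (weylModule t n) (weylModule_invariant t n)

/-- The representation `ρ_λ ⊗ ρ_z` of `𝔤𝔩ₙ = 𝔰𝔩ₙ ⊕ ℂ·1`: traceless matrices act on the Weyl module
as in `weylRep`, and the identity matrix acts by `z`. -/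
def twistedRep (n : ℕ) (z : ℂ) : gl n →ₗ⁅ℂ⁆ Module.End ℂ (Weyl t n) := twist (weylRep t n) z

end Young

/-- Isomorphism of representations. -/
def RepIso {𝔤 : Type*} [LieRing 𝔤] [LieAlgebra ℂ 𝔤] {V W : Type*} [AddCommGroup V] [Module ℂ V]
    [AddCommGroup W] [Module ℂ W] (ρ : 𝔤 →ₗ⁅ℂ⁆ Module.End ℂ V) (τ : 𝔤 →ₗ⁅ℂ⁆ Module.End ℂ W) :
    Prop :=
  ∃ f : V ≃ₗ[ℂ] W, ∀ x v, f (ρ x v) = τ x (f v)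

/-- An irreducible Young diagram representation of `𝔤𝔩ₙ`: the irreducible representation on the
Weyl module of a Young diagram with at most `n` rows, in either of the two usual normalisations of
the central action (the identity matrix acts by `1`, or by `|λ|` as it does on `(ℂⁿ)^{⊗ |λ|}`). -/
def IsYoungDiagramRep {n : ℕ} {V : Type*} [AddCommGroup V] [Module ℂ V]
    (ρ : gl n →ₗ⁅ℂ⁆ Module.End ℂ V) : Prop :=
  ∃ (Y : YoungDiagram) (t : Tableau Y), Y.colLen 0 ≤ n ∧
    (RepIso ρ (twistedRep t n 1) ∨ RepIso ρ (weylRep t n))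

end ChordDiagram

end

noncomputable section

namespace ChordDiagram

open scoped Matrix

/-! ### Unitary bases -/

/-! Suppose each `V i` has a basis in which `ρ i xᴴ` has the conjugate transpose of the matrix of `ρ
i x`. In the product basis every chord endomorphism is then Hermitian: conjugate transposition sends
an orthonormal basis of `𝔤𝔩ₙ` for the trace form to another one, and `∑ r, e r ⊗ e r` does not
depend on the orthonormal basis (`IsMetricBasis.sum_bilinear_eq`, `isHermitian_chordOp`). Reading a
diagram backwards therefore becomes conjugate transposition (`toMatrix_weightEnd_star`), so that `W
(x x⋆) = Tr (M Mᴴ) ≥ 0`, and `W 1` is the dimension of the tensor product.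

It remains to find such bases and to see that the representations are nonzero. The standard basis of
`ℂⁿ` is unitary, and unitarity passes to tensor powers, invariant subspaces
(`IsUnitaryBasis.exists_subRep`), real twists of the central action and isomorphic representations.
Weyl modules with at most `n` rows are nonzero (`weylModule_ne_bot`), which gives `W 1 > 0`. -/

/-- A basis in which `ρ xᴴ` is represented by the conjugate transpose of the matrix of `ρ x`. -/
def IsUnitaryBasis {n : ℕ} {ι V : Type*} [Fintype ι] [DecidableEq ι] [AddCommGroup V] [Module ℂ V]
    (ρ : gl n →ₗ⁅ℂ⁆ Module.End ℂ V) (b : Module.Basis ι ℂ V) : Prop :=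
  ∀ x : gl n, LinearMap.toMatrix b b (ρ xᴴ) = (LinearMap.toMatrix b b (ρ x))ᴴ

/-! ### Unitary bases of tensor products. -/

section Slot

variable {ι : Type*} [Fintype ι] [DecidableEq ι] {V : ι → Type*} [∀ i, AddCommGroup (V i)]
  [∀ i, Module ℂ (V i)] {κ : ι → Type*} [∀ i, Fintype (κ i)] [∀ i, DecidableEq (κ i)]

/-- Each entry in the product basis is a product over the strands: an entry of the given matrix on
strand `i` and a Kronecker delta, real and symmetric, on every other strand. -/
theorem toMatrix_slot_conjTranspose (b : ∀ i, Module.Basis (κ i) ℂ (V i)) (i : ι)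
    {f g : Module.End ℂ (V i)}
    (h : LinearMap.toMatrix (b i) (b i) g = (LinearMap.toMatrix (b i) (b i) f)ᴴ) :
    LinearMap.toMatrix (Basis.piTensorProduct b) (Basis.piTensorProduct b) (slot i g)
      = (LinearMap.toMatrix (Basis.piTensorProduct b) (Basis.piTensorProduct b) (slot i f))ᴴ := by
  ext p q
  simp only [Matrix.conjTranspose_apply, LinearMap.toMatrix_apply, Basis.piTensorProduct_apply,
    slot_tprod, Basis.piTensorProduct_repr_tprod_apply, star_prod]
  refine Finset.prod_congr rfl fun j _ => ?_
  by_cases hj : j = i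
  · subst hj
    simpa [LinearMap.toMatrix_apply] using congrFun (congrFun h (p j)) (q j)
  · simp only [Function.update_of_ne hj, Module.Basis.repr_self, Finsupp.single_apply,
      eq_comm (a := p j)]
    split_ifs <;> simp

theorem IsUnitaryBasis.tensorRep {n : ℕ} {ρ : ∀ i, gl n →ₗ⁅ℂ⁆ Module.End ℂ (V i)}
    {b : ∀ i, Module.Basis (κ i) ℂ (V i)} (hb : ∀ i, IsUnitaryBasis (ρ i) (b i)) :
    IsUnitaryBasis (tensorRep ρ) (Basis.piTensorProduct b) := by
  intro x
  change LinearMap.toMatrix _ _ (∑ i, slot i (ρ i xᴴ)) = (LinearMap.toMatrix _ _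
    (∑ i, slot i (ρ i x)))ᴴ
  rw [map_sum, map_sum, Matrix.conjTranspose_sum]
  exact Finset.sum_congr rfl fun i _ => toMatrix_slot_conjTranspose b i (hb i x)

end Slot

theorem isUnitaryBasis_stdRep (n : ℕ) : IsUnitaryBasis (stdRep n) (Pi.basisFun ℂ (Fin n)) := by
  intro x
  have h : ∀ y : gl n, LinearMap.toMatrix (Pi.basisFun ℂ (Fin n)) (Pi.basisFun ℂ (Fin n))
      (stdRep n y) = y := fun y => by
    rw [LinearMap.toMatrix_eq_toMatrix']
    exact LinearMap.toMatrix'_toLin' y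
  rw [h, h]

/-- The standard basis of `(ℂⁿ)^{⊗ k}`. -/
def tpowBasis (n k : ℕ) : Module.Basis (Fin k → Fin n) ℂ (TPow n k) :=
  Basis.piTensorProduct fun _ => Pi.basisFun ℂ (Fin n)

theorem isUnitaryBasis_tpowRep (n k : ℕ) : IsUnitaryBasis (tpowRep n k) (tpowBasis n k) :=
  IsUnitaryBasis.tensorRep fun _ => isUnitaryBasis_stdRep n

/-! ### Unitary bases under twists, isomorphisms and restriction. -/

section Transport

variable {n : ℕ} {V W : Type*} [AddCommGroup V] [Module ℂ V] [AddCommGroup W] [Module ℂ W]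
  {ι : Type*} [Fintype ι] [DecidableEq ι]

/-- The projection to the traceless part commutes with conjugate transposition, and the central
scalar is conjugated along with the trace because `z` is real. -/
theorem IsUnitaryBasis.twist {ρ : gl n →ₗ⁅ℂ⁆ Module.End ℂ V} {b : Module.Basis ι ℂ V}
    (hb : IsUnitaryBasis ρ b) {z : ℂ} (hz : star z = z) : IsUnitaryBasis (twist ρ z) b := by
  intro x
  change LinearMap.toMatrix b b (ρ (xᴴ - (xᴴ.trace / n) • (1 : gl n)) +
      (z * (xᴴ.trace / n)) • (1 : Module.End ℂ V))
    = (LinearMap.toMatrix b b (ρ (x - (x.trace / n) • (1 : gl n)) +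
      (z * (x.trace / n)) • (1 : Module.End ℂ V)))ᴴ
  have h : xᴴ - (xᴴ.trace / n) • (1 : gl n) = (x - (x.trace / n) • (1 : gl n))ᴴ := by
    simp [Matrix.trace_conjTranspose]
  rw [h, map_add, map_add, hb, Matrix.conjTranspose_add, map_smul, map_smul,
    Matrix.conjTranspose_smul, LinearMap.toMatrix_one, Matrix.conjTranspose_one,
    Matrix.trace_conjTranspose]
  simp only [star_mul', hz, star_div₀, star_natCast]

theorem IsUnitaryBasis.of_repIso {ρ : gl n →ₗ⁅ℂ⁆ Module.End ℂ V} {τ : gl n →ₗ⁅ℂ⁆ Module.End ℂ W}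
    {b : Module.Basis ι ℂ W} (hb : IsUnitaryBasis τ b) (f : V ≃ₗ[ℂ] W)
    (hf : ∀ x v, f (ρ x v) = τ x (f v)) : IsUnitaryBasis ρ (b.map f.symm) := by
  have h : ∀ x, LinearMap.toMatrix (b.map f.symm) (b.map f.symm) (ρ x)
      = LinearMap.toMatrix b b (τ x) := by
    intro x
    ext i j
    simp [LinearMap.toMatrix_apply, hf]
  intro x
  rw [h, h, hb]

/-- An invariant subspace of a representation with a unitary basis has a unitary basis. -/
theorem IsUnitaryBasis.exists_subRep {ρ : gl n →ₗ⁅ℂ⁆ Module.End ℂ V} {b : Module.Basis ι ℂ V}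
    (hb : IsUnitaryBasis ρ b) (U : Submodule ℂ V) (hU : ∀ x, ∀ v ∈ U, ρ x v ∈ U) :
    ∃ (d : ℕ) (c : Module.Basis (Fin d) ℂ U), IsUnitaryBasis (subRep ρ U hU) c := by
  -- `φ` carries over the Hermitian inner product for which `b` is orthonormal.
  let φ : V ≃ₗ[ℂ] EuclideanSpace ℂ ι :=
    b.equivFun ≪≫ₗ (WithLp.linearEquiv 2 ℂ (ι → ℂ)).symm
  have hφ : ∀ v i, φ v i = b.repr v i := fun v i => rfl
  -- For this inner product unitarity of `b` says that `ρ xᴴ` is the adjoint of `ρ x`, a property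
  -- that restricts to `U`.
  have hinner : ∀ x u v, inner ℂ (φ u) (φ (ρ x v)) = inner ℂ (φ (ρ xᴴ u)) (φ v) := by
    intro x u v
    have h1 : ∀ y w i, b.repr (ρ y w) i
        = ∑ j, LinearMap.toMatrix b b (ρ y) i j * b.repr w j := by
      intro y w i
      have := congrFun (LinearMap.toMatrix_mulVec_repr b b (ρ y) w) i
      rw [← this]
      rfl
    simp only [PiLp.inner_apply, hφ, h1, hb x, RCLike.inner_apply, map_sum, map_mul,
      Finset.sum_mul, Finset.mul_sum, Matrix.conjTranspose_apply]
    rw [Finset.sum_comm]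
    refine Finset.sum_congr rfl fun i _ => Finset.sum_congr rfl fun j _ => ?_
    simp only [starRingEnd_apply, star_star]
    ring
  let o := stdOrthonormalBasis ℂ (U.map (φ : V →ₗ[ℂ] EuclideanSpace ℂ ι))
  let ψ := φ.submoduleMap U
  refine ⟨_, o.toBasis.map ψ.symm, fun x => ?_⟩
  have hψ : ∀ u : U, ((ψ u : U.map (φ : V →ₗ[ℂ] EuclideanSpace ℂ ι)) : EuclideanSpace ℂ ι)
      = φ u := fun u => rfl
  -- As the new basis is orthonormal, matrix entries on `U` are inner products in the ambient space,
  -- to which `hinner` applies.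
  have entry : ∀ y i j, LinearMap.toMatrix (o.toBasis.map ψ.symm) (o.toBasis.map ψ.symm)
      (subRep ρ U hU y) i j = inner ℂ (φ (ψ.symm (o i))) (φ (ρ y (ψ.symm (o j)))) := by
    intro y i j
    have h2 : LinearMap.toMatrix (o.toBasis.map ψ.symm) (o.toBasis.map ψ.symm)
      (subRep ρ U hU y) i j = inner ℂ (o i) (ψ (subRep ρ U hU y (ψ.symm (o j)))) := by
      rw [← o.repr_apply_apply, LinearMap.toMatrix_apply]
      simp
    rw [h2, Submodule.coe_inner, hψ, ← hψ, ← hψ, LinearEquiv.apply_symm_apply]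
    rfl
  ext i j
  rw [Matrix.conjTranspose_apply, entry, entry, hinner, Matrix.conjTranspose_conjTranspose]
  exact (inner_conj_symm _ _).symm

end Transport

/-! ### Weyl modules do not vanish -/

theorem permRep_tpowBasis {n k : ℕ} (σ : Equiv.Perm (Fin k)) (p : Fin k → Fin n) :
    permRep n k σ (tpowBasis n k p) = tpowBasis n k (p ∘ σ.symm) := by
  rw [tpowBasis, Basis.piTensorProduct_apply, Basis.piTensorProduct_apply]
  exact PiTensorProduct.reindex_tprod _ _

/-- The symmetriser is applied to the basis tensor whose factor at each label is indexed by the row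
of its box. Only a permutation preserving rows fixes this tensor, and one that preserves both rows
and columns is trivial. The coefficient of the tensor in its own image is thus the order of the row
stabiliser, with no cancellation from the signs. -/
theorem weylModule_ne_bot {n : ℕ} {Y : YoungDiagram} (t : Tableau Y) (hY : Y.colLen 0 ≤ n) :
    weylModule t n ≠ ⊥ := by
  classical
  -- The first column is the longest, so the bound on `Y.colLen 0` makes every row number a valid
  -- index in `Fin n`.
  have hrow : ∀ c : Y.cells, c.1.1 < n := fun c =>
    lt_of_lt_of_le (YoungDiagram.mem_iff_lt_colLen.mp
      (Y.up_left_mem le_rfl (Nat.zero_le _) ((YoungDiagram.mem_cells c.1).mp c.2))) hY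
  let p : Fin Y.card → Fin n := fun a => ⟨(t.symm a).1.1, hrow _⟩
  have hp : ∀ a b, p a = p b ↔ (t.symm a).1.1 = (t.symm b).1.1 := fun a b => Fin.ext_iff
  -- `τ` does not change `p`, so the condition forces `σ` to preserve rows; it already preserves
  -- columns.
  have hcol : ∀ τ ∈ rowStab t, ∀ σ ∈ colStab t, p ∘ (τ * σ).symm = p ↔ σ = 1 := by
    intro τ hτ σ hσ
    constructor
    · intro h
      ext1 a
      have h1 : p a = p ((τ * σ) a) := by
        have := congrFun h ((τ * σ) a)
        rwa [Function.comp_apply, Equiv.symm_apply_apply] at this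
      have h2 : (t.symm (σ a)).1.1 = (t.symm a).1.1 := by
        rw [← hτ (σ a)]
        exact ((hp _ _).mp h1).symm
      exact t.symm.injective (Subtype.ext (Prod.ext h2 (hσ a)))
    · rintro rfl
      funext a
      rw [mul_one, Function.comp_apply, hp]
      simpa using (hτ (τ.symm a)).symm
  have hone : (1 : Equiv.Perm (Fin Y.card)) ∈ colStab t := fun a => rfl
  have hone' : (1 : Equiv.Perm (Fin Y.card)) ∈ rowStab t := fun a => rfl
  have key : (tpowBasis n Y.card).repr ((permRep n Y.card).asAlgebraHom (youngSymmetriser t)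
      (tpowBasis n Y.card p)) p
      = ((Finset.univ.filter fun σ => σ ∈ rowStab t).card : ℂ) := by
    rw [youngSymmetriser, Finset.sum_mul_sum]
    simp only [MonoidAlgebra.single_mul_single, map_sum, Representation.asAlgebraHom_single,
      LinearMap.sum_apply, LinearMap.smul_apply, permRep_tpowBasis, map_smul,
      Module.Basis.repr_self, Finsupp.finsetSum_apply, Finsupp.smul_apply, Finsupp.single_apply]
    rw [Finset.sum_congr rfl (g := fun _ => (1 : ℂ)), Finset.sum_const, nsmul_eq_mul, mul_one]
    intro τ hτ
    rw [Finset.sum_eq_single 1]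
    · rw [if_pos ((hcol τ (Finset.mem_filter.mp hτ).2 1 hone).mpr rfl)]
      simp
    · intro σ hσ hne
      rw [if_neg (mt (hcol τ (Finset.mem_filter.mp hτ).2 σ (Finset.mem_filter.mp hσ).2).mp hne),
        smul_zero]
    · intro h
      exact absurd (Finset.mem_filter.mpr ⟨Finset.mem_univ _, hone⟩) h
  intro hbot
  have hzero : (permRep n Y.card).asAlgebraHom (youngSymmetriser t) (tpowBasis n Y.card p) = 0 := by
    rw [← Submodule.mem_bot ℂ, ← hbot]
    exact LinearMap.mem_range_self _ _
  rw [hzero, map_zero, Finsupp.zero_apply, eq_comm, Nat.cast_eq_zero, Finset.card_eq_zero] at key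
  exact Finset.notMem_empty 1 (key ▸ Finset.mem_filter.mpr ⟨Finset.mem_univ _, hone'⟩)

/-- The basis comes from restricting the unitary structure of the tensor power to the Weyl module,
twisting by the real scalar `1` in the first normalisation, and transporting along the isomorphism.
-/
theorem IsYoungDiagramRep.exists_isUnitaryBasis {n : ℕ} {V : Type*} [AddCommGroup V] [Module ℂ V]
    {ρ : gl n →ₗ⁅ℂ⁆ Module.End ℂ V} (h : IsYoungDiagramRep ρ) :
    ∃ (d : ℕ) (b : Module.Basis (Fin d) ℂ V), d ≠ 0 ∧ IsUnitaryBasis ρ b := by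
  obtain ⟨Y, t, hY, h⟩ := h
  obtain ⟨d, c, hc⟩ := (isUnitaryBasis_tpowRep n Y.card).exists_subRep (weylModule t n)
    (weylModule_invariant t n)
  have hd : d ≠ 0 := by
    rintro rfl
    exact weylModule_ne_bot t hY ((Submodule.subsingleton_iff_eq_bot).mp
      c.repr.toEquiv.subsingleton)
  have hc' : IsUnitaryBasis (weylRep t n) (show Module.Basis (Fin d) ℂ (Weyl t n) from c) := hc
  rcases h with ⟨f, hf⟩ | ⟨f, hf⟩
  · exact ⟨d, _, hd, (hc'.twist (star_one ℂ)).of_repIso f hf⟩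
  · exact ⟨d, _, hd, hc'.of_repIso f hf⟩

/-! ### Positivity of the weight system -/

/-- The canonical element `∑ r, e r ⊗ e r` does not depend on the orthonormal basis. -/
theorem IsMetricBasis.sum_bilinear_eq {𝔤 : Type*} [LieRing 𝔤] [LieAlgebra ℂ 𝔤] {κ : Type*}
    [Fintype κ] [DecidableEq κ] {B : LinearMap.BilinForm ℂ 𝔤} {e : Module.Basis κ ℂ 𝔤}
    (he : IsMetricBasis B e) {f : κ → 𝔤} (hf : ∀ r s, B (f r) (f s) = if r = s then 1 else 0)
    {M : Type*} [AddCommGroup M] [Module ℂ M] (F : 𝔤 →ₗ[ℂ] 𝔤 →ₗ[ℂ] M) :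
    ∑ r, F (f r) (f r) = ∑ r, F (e r) (e r) := by
  let O : Matrix κ κ ℂ := Matrix.of fun r s => B (f r) (e s)
  -- The change of basis is complex orthogonal, with a transpose and no conjugation, because `B` is
  -- bilinear.
  have hO : O * Oᵀ = 1 := by
    ext r s
    rw [Matrix.one_apply, ← hf r s, Matrix.mul_apply]
    conv_rhs => rw [he.expand (f s)]
    simp only [map_sum, map_smul, smul_eq_mul, Matrix.transpose_apply, O, Matrix.of_apply]
    exact Finset.sum_congr rfl fun _ _ => mul_comm _ _
  -- `O` is square, so its right inverse `Oᵀ` is also a left inverse: the columns satisfy the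
  -- orthogonality relations too.
  have hO' : ∀ s u, ∑ r, B (f r) (e s) * B (f r) (e u) = if s = u then 1 else 0 := by
    intro s u
    rw [← Matrix.one_apply, ← mul_eq_one_comm.mp hO]
    rfl
  have hF : ∀ r, F (f r) (f r)
      = ∑ s, ∑ u, (B (f r) (e s) * B (f r) (e u)) • F (e s) (e u) := by
    intro r
    conv_lhs => rw [he.expand (f r)]
    simp only [map_sum, map_smul, LinearMap.sum_apply, LinearMap.smul_apply, smul_smul,
      Finset.smul_sum]
    rw [Finset.sum_comm]
    refine Finset.sum_congr rfl fun s _ => Finset.sum_congr rfl fun u _ => ?_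
    rw [mul_comm]
  simp only [hF]
  rw [Finset.sum_comm]
  refine Finset.sum_congr rfl fun s _ => ?_
  rw [Finset.sum_comm]
  simp [← Finset.sum_smul, hO']

section Positivity

variable {n N : ℕ} {κ : Type*} [Fintype κ] [DecidableEq κ] {e : Module.Basis κ ℂ (gl n)}
  {V : Fin N → Type*} [∀ i, AddCommGroup (V i)] [∀ i, Module ℂ (V i)]
  {ρ : ∀ i, gl n →ₗ⁅ℂ⁆ Module.End ℂ (V i)} {ι : Fin N → Type*} [∀ i, Fintype (ι i)]
  [∀ i, DecidableEq (ι i)] {b : ∀ i, Module.Basis (ι i) ℂ (V i)}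

/-- The chord endomorphisms are Hermitian. -/
theorem isHermitian_chordOp (he : IsMetricBasis (trForm n) e)
    (hb : ∀ i, IsUnitaryBasis (ρ i) (b i)) {i j : Fin N} (hij : i ≠ j) :
    (LinearMap.toMatrix (Basis.piTensorProduct b) (Basis.piTensorProduct b)
      (chordOp e ρ i j)).IsHermitian := by
  -- Since `Tr (Aᴴ Bᴴ)` is the conjugate of `Tr (B A)` and the Gram matrix is real, the family `(e
  -- r)ᴴ` is again orthonormal.
  have hf : ∀ r s, trForm n (e r)ᴴ (e s)ᴴ = if r = s then 1 else 0 := by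
    intro r s
    have h : trForm n (e r)ᴴ (e s)ᴴ = star (trForm n (e s) (e r)) := by
      change ((e r)ᴴ * (e s)ᴴ).trace = star (e s * e r).trace
      rw [← Matrix.conjTranspose_mul, Matrix.trace_conjTranspose]
    rw [h, he.orthonormal]
    simp only [eq_comm (a := s)]
    split_ifs <;> simp
  -- The bilinear map sends `(x, y)` to the action of `x` on strand `i` times that of `y` on strand
  -- `j`.
  have h := he.sum_bilinear_eq hf ((LinearMap.mul ℂ (Module.End ℂ (⨂[ℂ] i, V i))).compl₁₂
    (slotₗ i ∘ₗ (ρ i : gl n →ₗ[ℂ] Module.End ℂ (V i)))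
    (slotₗ j ∘ₗ (ρ j : gl n →ₗ[ℂ] Module.End ℂ (V j))))
  change ∑ r, slot i (ρ i (e r)ᴴ) * slot j (ρ j (e r)ᴴ) = chordOp e ρ i j at h
  rw [Matrix.IsHermitian]
  conv_rhs => rw [← h]
  rw [chordOp, map_sum, map_sum, Matrix.conjTranspose_sum]
  refine Finset.sum_congr rfl fun r _ => ?_
  -- Conjugate transposition reverses the two factors; acting on distinct strands, they commute,
  -- which restores the order.
  rw [slot_comm hij, LinearMap.toMatrix_mul, Matrix.conjTranspose_mul, LinearMap.toMatrix_mul,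
    toMatrix_slot_conjTranspose b i (hb i (e r)), toMatrix_slot_conjTranspose b j (hb j (e r))]

theorem weightEnd_diag_of {𝔤 : Type*} [LieRing 𝔤] [LieAlgebra ℂ 𝔤]
    {B : LinearMap.BilinForm ℂ 𝔤} {e : Module.Basis κ ℂ 𝔤} (he : IsMetricBasis B e)
    (ρ : ∀ i, 𝔤 →ₗ⁅ℂ⁆ Module.End ℂ (V i)) (c : Chord N) :
    weightEnd he ρ (diag (FreeMonoid.of c)) = chordOp e ρ c.1.1 c.1.2 := by
  rw [weightEnd, diag, MonoidHom.comp_apply]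
  refine (RingQuot.liftAlgHom_mkAlgHom_apply _ _ _ _).trans ?_
  simp [preWeight]

/-- In a basis that is unitary on every strand, the involution of chord diagrams becomes the
conjugate transpose. -/
theorem toMatrix_weightEnd_star (he : IsMetricBasis (trForm n) e)
    (hb : ∀ i, IsUnitaryBasis (ρ i) (b i)) (x : Alg N) :
    LinearMap.toMatrix (Basis.piTensorProduct b) (Basis.piTensorProduct b)
        (weightEnd he ρ (star x))
      = (LinearMap.toMatrix (Basis.piTensorProduct b) (Basis.piTensorProduct b)
        (weightEnd he ρ x))ᴴ := by
  induction x using alg_induction with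
  | ha x y hx hy => simp only [star_add, map_add, Matrix.conjTranspose_add, hx, hy]
  | hd z D =>
    rw [star_smul_diag, map_smul, map_smul, map_smul, map_smul, Matrix.conjTranspose_smul]
    congr 1
    -- Both operations reverse products, and each fixes a single chord: the star by definition, the
    -- conjugate transpose by Hermiticity.
    induction D using FreeMonoid.inductionOn' with
    | one => simp [LinearMap.toMatrix_one]
    | of_mul c D ih =>
      rw [star_mul, FreeMonoid.star_of, map_mul, map_mul, LinearMap.toMatrix_mul, map_mul, map_mul,
        LinearMap.toMatrix_mul, Matrix.conjTranspose_mul, ih, weightEnd_diag_of,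
        (isHermitian_chordOp he hb c.2.ne).eq]

/-- The weight system of a labelling by nonzero unitary representations is a quantum state. -/
theorem isQuantumState_weightSystem (he : IsMetricBasis (trForm n) e)
    (hb : ∀ i, IsUnitaryBasis (ρ i) (b i)) [∀ i, Nonempty (ι i)] :
    IsQuantumState (weightSystem he ρ) := by
  have htr : ∀ x, weightSystem he ρ x = (LinearMap.toMatrix (Basis.piTensorProduct b)
      (Basis.piTensorProduct b) (weightEnd he ρ x)).trace :=
    fun x => LinearMap.trace_eq_matrix_trace ℂ _ _
  refine ⟨fun x => ?_, ?_⟩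
  · rw [htr, map_mul, LinearMap.toMatrix_mul, toMatrix_weightEnd_star he hb]
    exact (Matrix.posSemidef_self_mul_conjTranspose _).trace_nonneg
  -- The trace counts the index set of the product basis, nonempty since every factor is; for `N =
  -- 0` it has one element.
  · rw [htr, map_one, LinearMap.toMatrix_one, Matrix.trace_one, Nat.cast_pos]
    exact Fintype.card_pos

end Positivity

end ChordDiagram

end

theorem mainTheorem2 {κ : Type*} [Fintype κ] [DecidableEq κ]
    (e : Module.Basis κ ℂ (ChordDiagram.gl 2))
    (he : ChordDiagram.IsMetricBasis (ChordDiagram.trForm 2) e)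
    (N : ℕ) (V : Fin N → Type*) [∀ i, AddCommGroup (V i)] [∀ i, Module ℂ (V i)]
    (ρ : ∀ i, ChordDiagram.gl 2 →ₗ⁅ℂ⁆ Module.End ℂ (V i))
    (hρ : ∀ i, ChordDiagram.IsYoungDiagramRep (ρ i)) :
    ChordDiagram.IsQuantumState (ChordDiagram.weightSystem he ρ) := by
  choose d b hd hb using fun i => (hρ i).exists_isUnitaryBasis
  have : ∀ i, Nonempty (Fin (d i)) := fun i => ⟨⟨0, Nat.pos_of_ne_zero (hd i)⟩⟩
  exact ChordDiagram.isQuantumState_weightSystem he hb
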